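/- For $a\in\mathbb C$ let $f_a(z)=az^2+1$. For $k\ge 2$, let $R_{k,3}$ be the monic polynomial with simple roots whose roots are exactly the parameters $a\in\mathbb C$ such that the critical point $0$ is preperiodic under $f_a$ with preperiod exactly $k$ and period exactly $3$ (that is, $f_a^{\circ k}(0)$ is a periodic point of exact period $3$, and $f_a^{\circ j}(0)$ is not periodic for $0\le j<k$), and $f_a^{\circ(k+2)}(0)=-f_a^{\circ(k-1)}(0)$. Then, for every $k\ge 2$, $R_{k,3}$ has integer coefficients and is irreducible over $\mathbb Q$. -/

import Mathlib

/-- The unicritical polynomial map `z ↦ a z ^ D + 1` of `ℂ`, with critical point `0`. -/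
def unicriticalMap (D : ℕ) (a : ℂ) : ℂ → ℂ := fun z => a * z ^ D + 1

/-- The orbit of `x` under `f` is eventually periodic with (exact) preperiod `k` and (exact)
period `n`: the first periodic point in the orbit `x, f x, f (f x), …` is `f^[k] x`, and its
minimal period is `n`. -/
def HasPreperiodAndPeriod {α : Type*} (f : α → α) (x : α) (k n : ℕ) : Prop :=
  f^[k] x ∈ Function.periodicPts f ∧
    (∀ j < k, f^[j] x ∉ Function.periodicPts f) ∧
    Function.minimalPeriod f (f^[k] x) = n

/-- The parameters `a` such that `0` is preperiodic under `f = unicriticalMap D a` with preperiod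
`k` and period `n`, and `f^[k + n - 1] 0 = ω * f^[k - 1] 0` for some primitive `d`-th root of
unity `ω`. (Used for `k ≥ 2`, `n ≥ 1`, so that the subtractions are genuine.) -/
def misiurewiczParams (D k n d : ℕ) : Set ℂ :=
  {a | HasPreperiodAndPeriod (unicriticalMap D a) 0 k n ∧
    ∃ ω : ℂ, IsPrimitiveRoot ω d ∧
      (unicriticalMap D a)^[k + n - 1] 0 = ω * (unicriticalMap D a)^[k - 1] 0}

/-- The monic polynomial `R_{k,n,d}` (for the degree `D`), as a polynomial over `ℂ`: its roots are
the elements of `misiurewiczParams D k n d`, each of them simple. -/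
noncomputable def misiurewiczPolyOfOrder (D k n d : ℕ) : Polynomial ℂ :=
  ∏ᶠ a ∈ misiurewiczParams D k n d, (Polynomial.X - Polynomial.C a)

/-- The polynomial `R_{k,n}` (for the degree `D`), as a polynomial over `ℂ`: the product of the
`R_{k,n,d}` over all divisors `d ≠ 1` of `D`. -/
noncomputable def misiurewiczPoly (D k n : ℕ) : Polynomial ℂ :=
  ∏ d ∈ D.divisors.erase 1, misiurewiczPolyOfOrder D k n d

open Polynomial

/-! Write P n for `critOrbit n`, q for `periodThreePoly` and k = m + 1. The parameters sought are
roots of P (m+3) + P m. Removing the factor P (m+1) + P m (where the orbit ends in a fixed point)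
and, if 3 ∣ m, one factor q (where 0 itself is periodic) leaves R.

Modulo 2, squaring is additive, so R reduces to a power of q, which is irreducible there. Modulo q,
R is 2 or 2X² + 2, which is nonzero modulo 4, so the generalized Eisenstein criterion applies.

Finally P (m+3) + P m has simple roots: no root of R is a root of a removed factor, so the roots of
R are exactly the parameters sought. -/

/-- The orbit of the critical point `0` of `z ↦ a z ^ 2 + 1`, as polynomials in `a`. -/
noncomputable def critOrbit : ℕ → ℤ[X]
  | 0 => 0
  | n + 1 => X * critOrbit n ^ 2 + 1

/-- The polynomial whose roots are the parameters for which `0` has period three. -/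
noncomputable def periodThreePoly : ℤ[X] := X ^ 3 + 2 * X ^ 2 + X + 1

/-- The cofactor of `critOrbit (m + 1) + critOrbit m` in `critOrbit (m + 3) + critOrbit m`. -/
noncomputable def orbitCofactor (m : ℕ) : ℤ[X] :=
  1 + X * (critOrbit (m + 1) - critOrbit m) * (1 + X * (critOrbit (m + 2) + critOrbit (m + 1)))

theorem critOrbit_zero : critOrbit 0 = 0 := rfl

theorem critOrbit_succ (n : ℕ) : critOrbit (n + 1) = X * critOrbit n ^ 2 + 1 := rfl

theorem critOrbit_three : critOrbit 3 = periodThreePoly := by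
  simp only [critOrbit_succ, critOrbit_zero, periodThreePoly]; ring

theorem periodThreePoly_monic : periodThreePoly.Monic := by
  unfold periodThreePoly; monicity!

/-- Telescope P (m+3) - P (m+1), using P (i+2) - P (i+1) = X (P (i+1) - P i)(P (i+1) + P i). -/
theorem critOrbit_add_mul_orbitCofactor (m : ℕ) :
    (critOrbit (m + 1) + critOrbit m) * orbitCofactor m = critOrbit (m + 3) + critOrbit m := by
  have h2 : critOrbit (m + 2) = X * critOrbit (m + 1) ^ 2 + 1 := critOrbit_succ _
  have h3 : critOrbit (m + 3) = X * critOrbit (m + 2) ^ 2 + 1 := critOrbit_succ _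
  have h1 := critOrbit_succ m
  unfold orbitCofactor
  linear_combination -(1 + X * (critOrbit (m + 2) + critOrbit (m + 1))) * (h2 - h1) - (h3 - h2)

theorem critOrbit_succ_monic_and_natDegree (m : ℕ) :
    (critOrbit (m + 1)).Monic ∧ (critOrbit (m + 1)).natDegree = 2 ^ m - 1 := by
  induction m with
  | zero => simp [critOrbit_succ, critOrbit_zero]
  | succ m ih =>
    obtain ⟨hm, hd⟩ := ih
    have hM : (X * critOrbit (m + 1) ^ 2 : ℤ[X]).Monic := monic_X.mul (hm.pow 2)
    have hD : (X * critOrbit (m + 1) ^ 2 : ℤ[X]).natDegree = 2 ^ (m + 1) - 1 := by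
      rw [monic_X.natDegree_mul (hm.pow 2), hm.natDegree_pow, hd, natDegree_X, pow_succ]
      have := Nat.one_le_two_pow (n := m)
      omega
    have hpos : 1 ≤ 2 ^ (m + 1) - 1 := by
      have := Nat.one_le_two_pow (n := m)
      rw [pow_succ]; omega
    rw [critOrbit_succ (m + 1)]
    refine ⟨hM.add_of_left ?_, ?_⟩
    · rw [degree_one, degree_eq_natDegree hM.ne_zero, hD]
      exact_mod_cast hpos
    · rw [← C_1, natDegree_add_C, hD]

theorem critOrbit_add_monic {m n : ℕ} (h : m < n) (hn : 2 ≤ n) :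
    (critOrbit n + critOrbit m).Monic := by
  obtain ⟨n, rfl⟩ : ∃ i, n = i + 1 := ⟨n - 1, by omega⟩
  obtain ⟨hM, hD⟩ := critOrbit_succ_monic_and_natDegree n
  refine hM.add_of_left ?_
  rcases m with _ | m
  · rw [critOrbit_zero, degree_zero, degree_eq_natDegree hM.ne_zero]
    exact WithBot.bot_lt_coe _
  · obtain ⟨hM', hD'⟩ := critOrbit_succ_monic_and_natDegree m
    rw [degree_eq_natDegree hM.ne_zero, degree_eq_natDegree hM'.ne_zero, hD, hD']
    have h1 : 2 ^ m < 2 ^ n := Nat.pow_lt_pow_right one_lt_two (by omega)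
    have h2 := Nat.one_le_two_pow (n := m)
    exact_mod_cast (by omega : 2 ^ m - 1 < 2 ^ n - 1)

theorem orbitCofactor_monic {m : ℕ} (hm : 1 ≤ m) : (orbitCofactor m).Monic := by
  refine (critOrbit_add_monic (Nat.lt_succ_self m) (by omega)).of_mul_monic_left ?_
  rw [critOrbit_add_mul_orbitCofactor]
  exact critOrbit_add_monic (by omega) (by omega)

/-! ### Residues modulo q and q² -/

/-- P 4 - P 1 = X q², and each such difference divides the next. The square is needed when q divides
the cofactor. -/
theorem sq_dvd_critOrbit_add_three_sub {m : ℕ} (hm : 1 ≤ m) :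
    periodThreePoly ^ 2 ∣ critOrbit (m + 3) - critOrbit m := by
  induction m, hm using Nat.le_induction with
  | base =>
    rw [critOrbit_succ 3, critOrbit_three]
    exact ⟨X, by simp only [critOrbit_succ, critOrbit_zero]; ring⟩
  | succ m _ ih =>
    obtain ⟨c, hc⟩ := ih
    refine ⟨X * (critOrbit (m + 3) + critOrbit m) * c, ?_⟩
    rw [show m + 1 + 3 = (m + 3) + 1 by omega, critOrbit_succ (m + 3), critOrbit_succ m]
    linear_combination X * (critOrbit (m + 3) + critOrbit m) * hc

theorem sq_dvd_critOrbit_sub_periodThreePoly (j : ℕ) :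
    periodThreePoly ^ 2 ∣ critOrbit (3 * (j + 1)) - periodThreePoly := by
  induction j with
  | zero => simp [critOrbit_three]
  | succ j ih =>
    have := dvd_add (sq_dvd_critOrbit_add_three_sub (m := 3 * (j + 1)) (by omega)) ih
    rwa [sub_add_sub_cancel] at this

theorem exists_critOrbit_eq (j : ℕ) : ∃ c d e : ℤ[X],
    critOrbit (3 * j) = periodThreePoly * c ∧
    critOrbit (3 * j + 1) = 1 + periodThreePoly * d ∧
    critOrbit (3 * j + 2) = 1 + X + periodThreePoly * e := by
  have h0 : ∃ c, critOrbit (3 * j) = periodThreePoly * c := by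
    rcases j with _ | j
    · exact ⟨0, by simp [critOrbit_zero]⟩
    · obtain ⟨c, hc⟩ := sq_dvd_critOrbit_sub_periodThreePoly j
      exact ⟨1 + periodThreePoly * c, by linear_combination hc⟩
  obtain ⟨c, hc⟩ := h0
  refine ⟨c, X * periodThreePoly * c ^ 2,
    X * (2 * (X * periodThreePoly * c ^ 2) + periodThreePoly * (X * periodThreePoly * c ^ 2) ^ 2),
    hc, ?_, ?_⟩
  · rw [critOrbit_succ, hc]; ring
  · rw [critOrbit_succ, critOrbit_succ, hc]; ring

/-- The polynomial `R_{m + 1, 3}` over the integers, together with its residue modulo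
`periodThreePoly`. -/
theorem exists_cofactor_residue {m : ℕ} (hm : 1 ≤ m) : ∃ R : ℤ[X],
    orbitCofactor m = R * periodThreePoly ^ (if 3 ∣ m then 1 else 0) ∧
    (periodThreePoly ∣ R - 2 ∨ periodThreePoly ∣ R - (2 * X ^ 2 + 2)) := by
  have hq0 := periodThreePoly_monic.ne_zero
  have hq : periodThreePoly = X ^ 3 + 2 * X ^ 2 + X + 1 := rfl
  obtain ⟨j, hj⟩ : ∃ j, m = 3 * j ∨ m = 3 * j + 1 ∨ m = 3 * j + 2 := ⟨m / 3, by omega⟩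
  obtain ⟨c, d, e, h0, h1, h2⟩ := exists_critOrbit_eq j
  obtain ⟨c', d', e', h3, h4, -⟩ := exists_critOrbit_eq (j + 1)
  rw [show 3 * (j + 1) = 3 * j + 3 by ring] at h3 h4
  rcases hj with rfl | rfl | rfl
  · obtain ⟨i, rfl⟩ : ∃ i, j = i + 1 := ⟨j - 1, by omega⟩
    have hd : periodThreePoly ∣ orbitCofactor (3 * (i + 1)) := by
      refine ⟨1 + X * (d - c) * (1 + X * (2 + X + periodThreePoly * (e + d))) +
        X * X * (e + d), ?_⟩
      unfold orbitCofactor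
      rw [h0, h1, h2]
      linear_combination -hq
    obtain ⟨R, hR⟩ := hd
    refine ⟨R, by rw [if_pos (Dvd.intro _ rfl), hR]; ring, Or.inl ?_⟩
    -- P (m+3) + P m ≡ 2q modulo q² and P (m+1) + P m ≡ 1 modulo q; cancelling q gives R ≡ 2.
    obtain ⟨u, hu⟩ := sq_dvd_critOrbit_add_three_sub (m := 3 * (i + 1)) (by omega)
    obtain ⟨v, hv⟩ := sq_dvd_critOrbit_sub_periodThreePoly i
    have hS := critOrbit_add_mul_orbitCofactor (3 * (i + 1))
    refine ⟨u + 2 * v - (d + c) * R, mul_left_cancel₀ hq0 ?_⟩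
    rw [hR, h0, h1] at hS
    rw [h0] at hu hv
    linear_combination hS + hu + 2 * hv
  · refine ⟨orbitCofactor (3 * j + 1), by rw [if_neg (by omega)]; ring, Or.inr ?_⟩
    -- Modulo q the cofactor is 1 + X²(1 + X + X²) = 2X² + 2 + (X - 1) q.
    refine ⟨X * (e - d) * (1 + X * (1 + X + periodThreePoly * (c' + e))) +
        X * X * X * (c' + e) + (X - 1), ?_⟩
    unfold orbitCofactor
    rw [h1, h2, h3]
    linear_combination (1 - X) * hq
  · refine ⟨orbitCofactor (3 * j + 2), by rw [if_neg (by omega)]; ring, Or.inl ?_⟩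
    -- Modulo q the cofactor is 1 - X(1 + X)² = 2 - q.
    refine ⟨X * (c' - e) * (1 + X * (1 + periodThreePoly * (c' + d'))) -
        X * (1 + X) * X * (c' + d') - 1, ?_⟩
    unfold orbitCofactor
    rw [h2, h3, h4]
    linear_combination hq

section ModTwo

/-- Reduction of integer polynomials modulo two. -/
noncomputable abbrev redTwo : ℤ[X] →+* (ZMod 2)[X] := mapRingHom (algebraMap ℤ (ZMod 2))

/-- Modulo 2 the sum S at index m becomes X S² at index m + 1. -/
theorem redTwo_critOrbit_add (i m : ℕ) :
    redTwo (critOrbit (m + i) + critOrbit m) =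
      X ^ (2 ^ m - 1) * redTwo (critOrbit i) ^ 2 ^ m := by
  induction m with
  | zero => simp [critOrbit_zero]
  | succ m ih =>
    have h2 : (2 : (ZMod 2)[X]) = 0 := CharTwo.two_eq_zero
    have hX : redTwo X = X := by simp
    rw [show m + 1 + i = (m + i) + 1 by omega, critOrbit_succ, critOrbit_succ]
    have : redTwo (X * critOrbit (m + i) ^ 2 + 1 + (X * critOrbit m ^ 2 + 1)) =
        X * redTwo (critOrbit (m + i) + critOrbit m) ^ 2 := by
      simp only [map_add, map_mul, map_pow, map_one, hX]
      linear_combination (1 - X * redTwo (critOrbit (m + i)) * redTwo (critOrbit m)) * h2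
    rw [this, ih, mul_pow, ← pow_mul, ← pow_mul, ← mul_assoc, ← pow_succ', ← pow_succ]
    congr 2
    have := Nat.one_le_two_pow (n := m)
    rw [pow_succ]; omega

theorem redTwo_orbitCofactor (m : ℕ) :
    redTwo (orbitCofactor m) = redTwo periodThreePoly ^ 2 ^ m := by
  have h := congrArg redTwo (critOrbit_add_mul_orbitCofactor m)
  rw [map_mul, redTwo_critOrbit_add, redTwo_critOrbit_add, critOrbit_three] at h
  have h1 : redTwo (critOrbit 1) = 1 := by simp [critOrbit_succ, critOrbit_zero]
  rw [h1, one_pow, mul_one] at h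
  exact mul_left_cancel₀ (pow_ne_zero _ X_ne_zero) h

theorem redTwo_periodThreePoly : redTwo periodThreePoly = X ^ 3 + X + 1 := by
  have h2 : (2 : (ZMod 2)[X]) = 0 := CharTwo.two_eq_zero
  simp [periodThreePoly, h2]

theorem irreducible_redTwo_periodThreePoly : Irreducible (redTwo periodThreePoly) := by
  rw [redTwo_periodThreePoly]
  have hd : (X ^ 3 + X + 1 : (ZMod 2)[X]).natDegree = 3 := by compute_degree!
  rw [irreducible_iff_roots_eq_zero_of_degree_le_three (by omega) (by omega)]
  refine Multiset.eq_zero_of_forall_notMem fun a ha => ?_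
  have h := (mem_roots'.1 ha).2
  simp only [IsRoot, eval_add, eval_pow, eval_X, eval_one] at h
  clear ha
  revert a
  decide

end ModTwo

/-! ### Irreducibility by the generalized Eisenstein criterion -/

theorem irreducible_of_residue {R : ℤ[X]} {n : ℕ} (hM : R.Monic) (hn : n ≠ 0)
    (hmod : redTwo R = redTwo periodThreePoly ^ n)
    (hres : periodThreePoly ∣ R - 2 ∨ periodThreePoly ∣ R - (2 * X ^ 2 + 2)) :
    Irreducible R := by
  have hq := periodThreePoly_monic
  have hqd : periodThreePoly.natDegree = 3 := by unfold periodThreePoly; compute_degree!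
  refine generalizedEisenstein (K := ZMod 2) (q := periodThreePoly) (p := n)
    irreducible_redTwo_periodThreePoly hq hM.isPrimitive ?_ (by simp [hM.leadingCoeff]) ?_ ?_
  · rw [← hM.natDegree_map (algebraMap ℤ (ZMod 2))]
    change 0 < (redTwo R).natDegree
    rw [hmod, (show (redTwo periodThreePoly).Monic from hq.map _).natDegree_pow]
    change 0 < n * (periodThreePoly.map _).natDegree
    rw [hq.natDegree_map, hqd]
    omega
  · rw [hM.leadingCoeff, map_one, C_1, one_mul]; exact hmod
  · have hker : RingHom.ker (algebraMap ℤ (ZMod 2)) ^ 2 = Ideal.span {(4 : ℤ)} := by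
      rw [algebraMap_int_eq, ZMod.ker_intCastRingHom, Ideal.span_singleton_pow]; norm_num
    -- Both possible remainders have constant term 2, which is not divisible by 4.
    have hcoeff : (R %ₘ periodThreePoly).coeff 0 = 2 := by
      have key : ∀ r : ℤ[X], r.degree < 3 → periodThreePoly ∣ R - r →
          R %ₘ periodThreePoly = r := by
        rintro r hr ⟨c, hc⟩
        refine (div_modByMonic_unique c r hq ⟨by linear_combination -hc, ?_⟩).2
        rwa [degree_eq_natDegree hq.ne_zero, hqd]
      rcases hres with h | h
      · rw [key 2 (by rw [← C_ofNat]; exact degree_C_le.trans_lt (by norm_num)) h]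
        simp
      · rw [key _ ?_ h]
        · simp
        · refine lt_of_le_of_lt (b := 2) ?_ (by norm_num)
          compute_degree!
    intro h
    have h0 := congrArg (fun f => coeff f 0) h
    simp only [coeff_map, hcoeff, coeff_zero] at h0
    rw [Ideal.Quotient.eq_zero_iff_mem, hker, Ideal.mem_span_singleton] at h0
    omega

/-! ### Simplicity of the roots -/

theorem two_mul_ne_one_of_isIntegral {w : ℂ} (hw : IsIntegral ℤ w) : 2 * w ≠ 1 := by
  intro h
  have h' : algebraMap ℚ ℂ (1 / 2) = w := by
    simp only [map_div₀, map_one, map_ofNat]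
    linear_combination -(1 / 2 : ℂ) * h
  rw [← h', isIntegral_algebraMap_iff (algebraMap ℚ ℂ).injective] at hw
  obtain ⟨n, hn⟩ := IsIntegrallyClosed.isIntegral_iff.1 hw
  have : (2 * n : ℚ) = 1 := by
    rw [eq_intCast] at hn
    rw [hn]; norm_num
  have : 2 * n = 1 := by exact_mod_cast this
  omega

/-- For n ≥ 1, modulo 2 the derivative of P n is P (n-1)², and X P (n-1)² = P n - 1. -/
theorem exists_critOrbit_mul_derivative (n : ℕ) : ∃ w : ℤ[X],
    X * critOrbit n * derivative (critOrbit n) = critOrbit n ^ 2 - critOrbit n + 2 * w := by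
  rcases n with _ | n
  · exact ⟨0, by simp [critOrbit_zero]⟩
  · refine ⟨X ^ 2 * critOrbit (n + 1) * critOrbit n * derivative (critOrbit n), ?_⟩
    have h : derivative (critOrbit (n + 1)) =
        critOrbit n ^ 2 + 2 * X * critOrbit n * derivative (critOrbit n) := by
      rw [critOrbit_succ]
      simp only [derivative_add, derivative_mul, derivative_X, derivative_pow, derivative_one]
      simp
      ring
    rw [h]
    linear_combination (-critOrbit (n + 1)) * critOrbit_succ n

/-- The polynomials `critOrbit (m + 3) + critOrbit m` have simple roots. -/
theorem aeval_derivative_ne_zero {m : ℕ} (hm : 1 ≤ m) {a : ℂ}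
    (ha : aeval a (critOrbit (m + 3) + critOrbit m) = 0) :
    aeval a (derivative (critOrbit (m + 3) + critOrbit m)) ≠ 0 := by
  intro ha'
  have hint : IsIntegral ℤ a := ⟨_, critOrbit_add_monic (by omega) (by omega), ha⟩
  have hp : ∀ f : ℤ[X], IsIntegral ℤ (aeval a f) := fun f => by
    have h := (aeval (⟨a, hint⟩ : integralClosure ℤ ℂ) f).2
    rwa [← Subalgebra.aeval_coe] at h
  obtain ⟨i, rfl⟩ : ∃ i, m = i + 1 := ⟨m - 1, by omega⟩
  obtain ⟨u, hu⟩ := exists_critOrbit_mul_derivative i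
  obtain ⟨v, hv⟩ := exists_critOrbit_mul_derivative (i + 3)
  rw [show i + 1 + 3 = (i + 3) + 1 by omega, critOrbit_succ (i + 3), critOrbit_succ i] at ha ha'
  simp only [derivative_add, derivative_mul, derivative_X, derivative_pow, derivative_one] at ha'
  replace hu := congrArg (aeval a) hu
  replace hv := congrArg (aeval a) hv
  simp only [map_add, map_mul, map_sub, map_pow, map_one, aeval_X, map_ofNat,
    Nat.cast_ofNat, Nat.add_one_sub_one, pow_one, one_mul, add_zero] at ha ha' hu hv
  set x := aeval a (critOrbit (i + 3))
  set y := aeval a (critOrbit i)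
  -- At a double root a(x + y) would be odd, but its square is 2a²xy - 2a because a(x² + y²) = -2.
  -- This would make 1/2 integral.
  have h1 : a * (x + y) = 2 * (a * (aeval a u + aeval a v) - 2) + 1 := by
    linear_combination (-1 / 2 * a) * ha' + a * hu + a * hv + (3 / 2 : ℂ) * ha
  have hu' := hp u
  have hv' := hp v
  have hx : IsIntegral ℤ x := hp _
  have hy : IsIntegral ℤ y := hp _
  have htwo : IsIntegral ℤ (2 : ℂ) := by exact_mod_cast isIntegral_algebraMap (R := ℤ) (x := 2)
  have ht : IsIntegral ℤ (a * (aeval a u + aeval a v) - 2) := (hint.mul (hu'.add hv')).sub htwo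
  generalize a * (aeval a u + aeval a v) - 2 = t at h1 ht
  refine two_mul_ne_one_of_isIntegral (w := a ^ 2 * x * y - a - 2 * t ^ 2 - 2 * t) ?_ ?_
  · exact (((((hint.pow 2).mul hx).mul hy).sub hint).sub (htwo.mul (ht.pow 2))).sub (htwo.mul ht)
  · linear_combination (a * (x + y) + 2 * t + 1) * h1 - a * ha

theorem aeval_ne_zero_of_aeval_derivative_mul_ne_zero {A B : ℤ[X]} {a : ℂ}
    (h : aeval a (derivative (A * B)) ≠ 0) (hA : aeval a A = 0) :
    aeval a B ≠ 0 ∧ aeval a (derivative A) ≠ 0 := by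
  rw [derivative_mul, map_add, map_mul, map_mul, hA, zero_mul, add_zero] at h
  exact ⟨right_ne_zero_of_mul h, left_ne_zero_of_mul h⟩

/-! ### Roots of R and the dynamics -/

theorem aeval_critOrbit (a : ℂ) (n : ℕ) :
    aeval a (critOrbit n) = (unicriticalMap 2 a)^[n] 0 := by
  induction n with
  | zero => simp [critOrbit_zero]
  | succ n ih =>
    rw [Function.iterate_succ_apply', ← ih, critOrbit_succ]
    simp [unicriticalMap]

theorem mem_misiurewiczParams_iff {m : ℕ} (hm : 1 ≤ m) {R : ℤ[X]}
    (hR : orbitCofactor m = R * periodThreePoly ^ (if 3 ∣ m then 1 else 0)) (a : ℂ) :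
    a ∈ misiurewiczParams 2 (m + 1) 3 2 ↔ aeval a R = 0 := by
  set f := unicriticalMap 2 a with hf
  have hP : ∀ n, aeval a (critOrbit n) = f^[n] 0 := aeval_critOrbit a
  have hq : aeval a periodThreePoly = f^[3] 0 := by rw [← critOrbit_three, hP]
  have hneg : ∀ z, f (-z) = f z := fun z => by simp [hf, unicriticalMap]
  have hS : aeval a (critOrbit (m + 3) + critOrbit m) = f^[m + 3] 0 + f^[m] 0 := by
    rw [map_add, hP, hP]
  have hT : aeval a (critOrbit (m + 1) + critOrbit m) = f^[m + 1] 0 + f^[m] 0 := by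
    rw [map_add, hP, hP]
  have hfac := critOrbit_add_mul_orbitCofactor m
  constructor
  · rintro ⟨⟨-, hnot, hmin⟩, ω, hω, h⟩
    rw [hω.eq_neg_one_of_two_right] at h
    replace h : f^[m + 3] 0 = -1 * f^[m] 0 := h
    have hT0 : aeval a (critOrbit (m + 1) + critOrbit m) ≠ 0 := by
      intro h0
      rw [hT] at h0
      have hfix : Function.IsFixedPt f (f^[m + 1] 0) := by
        rw [Function.IsFixedPt, eq_neg_of_add_eq_zero_left h0, hneg,
          ← Function.iterate_succ_apply' f m, eq_neg_of_add_eq_zero_left h0]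
      rw [Function.minimalPeriod_eq_one_iff_isFixedPt.2 hfix] at hmin
      omega
    have hq0 : aeval a periodThreePoly ≠ 0 := fun h0 =>
      hnot 0 (by omega) ⟨3, by omega, (hq.symm.trans h0 : f^[3] 0 = 0)⟩
    have h0 : aeval a ((critOrbit (m + 1) + critOrbit m) * orbitCofactor m) = 0 := by
      rw [hfac, hS, h]; ring
    rw [hR, map_mul, map_mul, map_pow] at h0
    exact (mul_eq_zero.1 ((mul_eq_zero.1 h0).resolve_left hT0)).resolve_right (pow_ne_zero _ hq0)
  · intro hR0
    have hU0 : aeval a (orbitCofactor m) = 0 := by rw [hR, map_mul, hR0, zero_mul]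
    have hS0 : aeval a (critOrbit (m + 3) + critOrbit m) = 0 := by
      rw [← hfac, map_mul, hU0, mul_zero]
    have hsep := aeval_derivative_ne_zero hm hS0
    have hT0 : aeval a (critOrbit (m + 1) + critOrbit m) ≠ 0 := by
      rw [← hfac, mul_comm] at hsep
      exact (aeval_ne_zero_of_aeval_derivative_mul_ne_zero hsep hU0).1
    have hq0 : 3 ∣ m → aeval a periodThreePoly ≠ 0 := by
      intro h3
      rw [← hfac, mul_comm, hR, if_pos h3, pow_one, mul_assoc] at hsep
      have := (aeval_ne_zero_of_aeval_derivative_mul_ne_zero hsep hR0).1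
      rw [map_mul] at this
      exact left_ne_zero_of_mul this
    rw [hT] at hT0
    rw [hS] at hS0
    rw [hq] at hq0
    have hm3 : f^[m + 3] 0 = -f^[m] 0 := eq_neg_of_add_eq_zero_left hS0
    have hper : Function.IsPeriodicPt f 3 (f^[m + 1] 0) := by
      change f^[3] (f^[m + 1] 0) = f^[m + 1] 0
      rw [← Function.iterate_add_apply, show 3 + (m + 1) = (m + 3) + 1 by omega,
        Function.iterate_succ_apply', hm3, hneg, ← Function.iterate_succ_apply' f m]
    have hmin : Function.minimalPeriod f (f^[m + 1] 0) = 3 := by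
      refine (Nat.prime_three.eq_one_or_self_of_dvd _ hper.minimalPeriod_dvd).resolve_left ?_
      intro h1
      have hfix := Function.minimalPeriod_eq_one_iff_isFixedPt.1 h1
      have h2 : f^[2] (f^[m + 1] 0) = f^[m + 1] 0 := hfix.iterate 2
      rw [← Function.iterate_add_apply, show 2 + (m + 1) = m + 3 by omega, hm3] at h2
      exact hT0 (by rw [← h2]; ring)
    refine ⟨⟨⟨3, by omega, hper⟩, ?_, hmin⟩, -1, IsPrimitiveRoot.neg_one 0 (by omega), ?_⟩
    · rintro j hj ⟨n, hn, hjn⟩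
      -- An earlier periodic point makes f^[m] 0 periodic of period 3, hence equal to its own
      -- negative, so 0. Then 3 ∣ m and q vanishes at a, against simplicity.
      have hmper : f^[m] 0 ∈ Function.periodicPts f := by
        refine ⟨n, hn, ?_⟩
        have := hjn.apply_iterate (m - j)
        rwa [← Function.iterate_add_apply, show m - j + j = m by omega] at this
      have hmin' : Function.minimalPeriod f (f^[m] 0) = 3 := by
        rw [← Function.minimalPeriod_apply hmper, ← Function.iterate_succ_apply' f m, hmin]
      have h3 : f^[3] (f^[m] 0) = f^[m] 0 := hmin' ▸ Function.isPeriodicPt_minimalPeriod f _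
      have hm0 : f^[m] 0 = 0 := by
        rw [← Function.iterate_add_apply, add_comm, hm3] at h3
        linear_combination (-1 / 2 : ℂ) * h3
      rw [hm0] at h3 hmin'
      exact hq0 (hmin' ▸ Function.IsPeriodicPt.minimalPeriod_dvd hm0) h3
    · change f^[m + 3] 0 = -1 * f^[m] 0
      rw [hm3, neg_one_mul]

theorem mainTheorem5 (k : ℕ) (hk : 2 ≤ k) :
    ∃ R : Polynomial ℤ,
      R.map (Int.castRingHom ℂ) = misiurewiczPoly 2 k 3 ∧
        Irreducible (R.map (Int.castRingHom ℚ)) := by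
  obtain ⟨m, rfl⟩ : ∃ m, k = m + 1 := ⟨k - 1, by omega⟩
  have hm : 1 ≤ m := by omega
  obtain ⟨R, hR, hres⟩ := exists_cofactor_residue hm
  have hM : R.Monic := by
    refine (periodThreePoly_monic.pow (if 3 ∣ m then 1 else 0)).of_mul_monic_right ?_
    rw [← hR]
    exact orbitCofactor_monic hm
  have hirr : Irreducible R := by
    have h2 : 2 ≤ 2 ^ m := Nat.le_self_pow (by omega) 2
    have he : (if 3 ∣ m then 1 else 0) ≤ 1 := by split_ifs <;> omega
    refine irreducible_of_residue (n := 2 ^ m - if 3 ∣ m then 1 else 0) hM (by omega) ?_ hres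
    have h := redTwo_orbitCofactor m
    rw [hR, map_mul, map_pow] at h
    refine mul_right_cancel₀
      (pow_ne_zero _ irreducible_redTwo_periodThreePoly.ne_zero) (h.trans ?_)
    rw [← pow_add]
    congr 1
    omega
  refine ⟨R, ?_, (IsPrimitive.Int.irreducible_iff_irreducible_map_cast hM.isPrimitive).1 hirr⟩
  set F := R.map (Int.castRingHom ℂ) with hF
  have hFM : F.Monic := hM.map _
  have hFroot : ∀ a, F.IsRoot a ↔ aeval a R = 0 := fun a => by
    rw [IsRoot, hF, eval_map, aeval_def]; rfl
  have hnodup : F.roots.Nodup := by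
    refine Multiset.nodup_iff_count_le_one.2 fun a => ?_
    by_contra! hlt
    rw [count_roots, one_lt_rootMultiplicity_iff_isRoot hFM.ne_zero] at hlt
    obtain ⟨h0, h1⟩ := hlt
    rw [hFroot] at h0
    rw [IsRoot, hF, derivative_map, eval_map] at h1
    have hfac := critOrbit_add_mul_orbitCofactor m
    rw [hR, mul_left_comm] at hfac
    have hsep := aeval_derivative_ne_zero hm (a := a) (by rw [← hfac, map_mul, h0, zero_mul])
    rw [← hfac] at hsep
    exact (aeval_ne_zero_of_aeval_derivative_mul_ne_zero hsep h0).2 h1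
  have hset : misiurewiczParams 2 (m + 1) 3 2 = (F.roots.toFinset : Set ℂ) := by
    ext a
    rw [mem_misiurewiczParams_iff hm hR, ← hFroot]
    simp [hFM.ne_zero]
  have hdiv : (2 : ℕ).divisors.erase 1 = {2} := by decide
  rw [misiurewiczPoly, hdiv, Finset.prod_singleton, misiurewiczPolyOfOrder, hset,
    finprod_mem_coe_finset]
  conv_lhs => rw [(IsAlgClosed.splits F).eq_prod_roots_of_monic hFM]
  rw [Finset.prod, Multiset.toFinset_val, hnodup.dedup]
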